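/- Let $q\ge 3$ be a prime power and let $n$ be a positive integer with $\gcd(q,n)=1$. Let $m=\operatorname{ord}_n(q)$ be the multiplicative order of $q$ modulo $n$, and let $r\ge 1$ and $1\le a_1,\dots,a_r<m$ be integers. Assume that $n>m\ge r+2$ and that $\gcd(q^{a_i}-1,n)=1$ for $i=1,\dots,r$. Assume also that $n\mid\gcd(t_2,\dots,t_r)$ (no condition if $r=1$), where, with all operations performed modulo $n$, $$t_j=\bigl(j-(j-1)q^{a_j}\bigr)\bigl(q^{a_j}-1\bigr)^{-1}-\bigl(q^{a_1}-1\bigr)^{-1},\qquad j=2,\dots,r.$$ For $s\in\mathbb Z/n$ let $C_s=\{s,sq,sq^2,\dots\}\subseteq\mathbb Z/n$ be its $q$-cyclotomic coset. Let $\alpha$ be a primitive $n$-th root of unity in an extension field of $\mathbb F_q$. A cyclic code of length $n$ is a nonzero ideal of $\mathbb F_q[X]/(X^n-1)$, viewed also as a linear code in $\mathbb F_q^n$. Its defining set is the set of all $z\in\mathbb Z/n$ such that $\alpha^z$ is a zero of all its codewords. Then some coset $C_x$ contains $r+1$ consecutive integers (modulo $n$). Moreover, let $C_x$ be any coset containing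 $r+1$ consecutive integers modulo $n$, put $m^*=|C_x|$, and suppose $C_x\ne C_{-x}$. Then $2m^*<n$, the cyclic code $C$ with defining set $C_x$ exists, and $C$ contains its Euclidean dual $C^\perp$. The quantum code obtained from $C$ by the CSS construction, namely the span in $(\mathbb C^q)^{\otimes n}$ of the vectors $\sum_{w\in C^\perp}|v+w\rangle$ with $v\in C$, is an $[[n,\,n-2m^*,\,d\ge r+2]]_q$ quantum code: it has dimension $q^{n-2m^*}$ and minimum distance at least $r+2$. -/

import Mathlib

open Polynomial

noncomputable section

/-! ## Cyclotomic cosets -/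

/-- The `q`-cyclotomic coset `{s, sq, sq², …}` of `s` modulo `n`. -/
def qCoset (q n : ℕ) (s : ZMod n) : Set (ZMod n) :=
  Set.range fun k : ℕ => s * (q : ZMod n) ^ k

/-- `S` contains `l` consecutive integers `b, b + 1, …, b + l - 1`, read modulo `n`. -/
def HasConsecutive {n : ℕ} (l : ℕ) (S : Set (ZMod n)) : Prop :=
  ∃ b : ZMod n, ∀ i : ℕ, i < l → b + (i : ZMod n) ∈ S

/-- `t_j = (j - (j-1) q^{a_j}) (q^{a_j} - 1)⁻¹ - (q^{a_1} - 1)⁻¹`, computed modulo `n`. -/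
def tParam (q n : ℕ) (a : ℕ → ℕ) (j : ℕ) : ZMod n :=
  ((j : ZMod n) - ((j : ZMod n) - 1) * (q : ZMod n) ^ a j) * ((q : ZMod n) ^ a j - 1)⁻¹
    - ((q : ZMod n) ^ a 1 - 1)⁻¹

/-! ## Cyclic codes -/

/-- The ring `R_n = F[x] / (x^n - 1)`. -/
abbrev CyclicRing (F : Type*) [Field F] (n : ℕ) : Type _ :=
  F[X] ⧸ Ideal.span {(X : F[X]) ^ n - 1}

/-- The class of a polynomial in `R_n`. -/
abbrev CyclicRing.mk (F : Type*) [Field F] (n : ℕ) : F[X] →+* CyclicRing F n :=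
  Ideal.Quotient.mk (Ideal.span {(X : F[X]) ^ n - 1})

/-- A cyclic code of length `n` is a nonzero ideal of `R_n`. -/
def IsCyclicCode {F : Type*} [Field F] {n : ℕ} (I : Ideal (CyclicRing F n)) : Prop :=
  I ≠ ⊥

/-- The defining set, with respect to the primitive `n`-th root of unity `α`: the exponents `z`
such that `α ^ z` is a zero of every codeword (equivalently, of the generator polynomial). -/
def definingSet {F E : Type*} [Field F] [Field E] [Algebra F E] {n : ℕ} (α : E)
    (I : Ideal (CyclicRing F n)) : Set (ZMod n) :=
  {z | ∀ p : F[X], CyclicRing.mk F n p ∈ I → aeval (α ^ z.val) p = 0}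

/-- The identification `(c_0, …, c_{n-1}) ↦ c_0 + c_1 x + ⋯ + c_{n-1} x^{n-1}` of `F^n`
with `R_n`. -/
def vecToRing (F : Type*) [Field F] (n : ℕ) : (Fin n → F) →ₗ[F] CyclicRing F n :=
  Fintype.linearCombination F fun i : Fin n => CyclicRing.mk F n (X ^ (i : ℕ))

/-- An ideal of `R_n` as a linear code in `F^n`. -/
def toLinearCode {F : Type*} [Field F] {n : ℕ} (I : Ideal (CyclicRing F n)) :
    Submodule F (Fin n → F) :=
  (I.restrictScalars F).comap (vecToRing F n)

/-- The Euclidean dual of a linear code. -/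
def euclideanDual {F : Type*} [Field F] {n : ℕ} (C : Submodule F (Fin n → F)) :
    Submodule F (Fin n → F) where
  carrier := {y | ∀ c ∈ C, ∑ i, c i * y i = 0}
  add_mem' := by
    intro y z hy hz c hc
    simp [mul_add, Finset.sum_add_distrib, hy c hc, hz c hc]
  zero_mem' := by
    intro c _
    simp
  smul_mem' := by
    intro t y hy c hc
    have h : ∑ i, c i * (t • y) i = t * ∑ i, c i * y i := by
      rw [Finset.mul_sum]
      exact Finset.sum_congr rfl fun i _ => by simp [mul_left_comm]
    rw [h, hy c hc, mul_zero]

/-! ## Quantum codes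

With `q = |ι|`, the Hilbert space `(ℂ^q)^{⊗ n}` is realized through its computational basis
`|u⟩ = |u_1⟩ ⊗ ⋯ ⊗ |u_n⟩`, `u ∈ ι^n`: a vector is the family of its `q^n` coordinates. -/

/-- The Hilbert space `(ℂ^q)^{⊗ n}`, where `q = |ι|`. -/
abbrev QuditSpace (ι : Type*) (n : ℕ) : Type _ := EuclideanSpace ℂ (Fin n → ι)

/-- The matrix of the operator `A_1 ⊗ ⋯ ⊗ A_n` in the computational basis. -/
def tensorOp {ι : Type*} {n : ℕ} (A : Fin n → Matrix ι ι ℂ) :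
    Matrix (Fin n → ι) (Fin n → ι) ℂ :=
  Matrix.of fun u v => ∏ i, A i (u i) (v i)

/-- `Q` detects every error `E = A_1 ⊗ ⋯ ⊗ A_n` of weight less than `d`, the weight being the
number of factors different from the identity: there is a scalar `c_E` with
`⟨φ, E ψ⟩ = c_E ⟨φ, ψ⟩` on `Q`, that is, `P E P = c_E P` for the orthogonal projection `P`
onto `Q`. For `dim Q > 1` this says that the minimum distance of `Q` is at least `d`. (The
condition is linear in `E`, so it then holds for all operators acting on fewer than `d`
tensor factors.) -/
def DetectsBelow {ι : Type*} [Fintype ι] [DecidableEq ι] {n : ℕ} (d : ℕ)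
    (Q : Submodule ℂ (QuditSpace ι n)) : Prop :=
  ∀ A : Fin n → Matrix ι ι ℂ, {i | A i ≠ 1}.ncard < d →
    ∃ c : ℂ, ∀ φ ∈ Q, ∀ ψ ∈ Q,
      inner ℂ φ (Matrix.toEuclideanLin (tensorOp A) ψ) = c * inner ℂ φ ψ

/-- `Q` is an `[[n, k, ≥ d]]_q` quantum code (for `k ≥ 1`), where `q = |ι|`. -/
def IsQuantumCode {ι : Type*} [Fintype ι] [DecidableEq ι] {n : ℕ} (k d : ℕ)
    (Q : Submodule ℂ (QuditSpace ι n)) : Prop :=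
  Module.finrank ℂ Q = Fintype.card ι ^ k ∧ DetectsBelow d Q

/-- The (unnormalized) coset state `∑_{w ∈ D} |v + w⟩`. -/
def cosetState {F : Type*} [Field F] {n : ℕ} (D : Submodule F (Fin n → F)) (v : Fin n → F) :
    QuditSpace F n :=
  WithLp.toLp 2 (Set.indicator {u | u - v ∈ D} fun _ => (1 : ℂ))

/-- The quantum code given by the Calderbank–Shor–Steane construction from a dual-containing
code `C`: the span of the coset states `∑_{w ∈ C^⊥} |v + w⟩`, `v ∈ C`. -/
def cssCode {F : Type*} [Field F] {n : ℕ} (C : Submodule F (Fin n → F)) :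
    Submodule ℂ (QuditSpace F n) :=
  Submodule.span ℂ (cosetState (euclideanDual C) '' (C : Set (Fin n → F)))

end

/-! Put `y = (q^{a_1} - 1)⁻¹` in `ZMod n`. Then `y + 1 = y q^{a_1}`, and `t_j = 0` rearranges to `y
+ j = (y + j - 1) q^{a_j}`. Hence `y, y + 1, …, y + r` all lie in one coset
(`hasConsecutive_qCoset`).

For a coset `C_x ≠ C_{-x}`, the two are disjoint, and `0` is in neither, so `2|C_x| < n`. The code
`C` consists of the words whose polynomial vanishes at `α^x`, and it has dimension `n - |C_x|`
(`finrank_toLinearCode`). A dual word vanishes at `α^z` whenever `-z` is not in the defining set, so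
disjointness gives `C^⊥ ⊆ C` (`euclideanDual_toLinearCode_le`).

The coset states of `C / C^⊥` are orthogonal, so the CSS code has dimension `q^(n - 2|C_x|)`
(`finrank_cssCode`). By the BCH bound, no nonzero word of `C` is supported on `r + 1` or fewer
positions. For an error supported on a set `S` of such positions, this has two effects: matrix
entries between different basis words of the same coset of `C` vanish, and `C^⊥` restricts onto
`F^S`, so every coset state sees the same diagonal sum. These are the Knill–Laflamme conditions
(`inner_tensorOp_of_cosetState`). -/

noncomputable section

/-! ### Powers of a root of unity with exponents modulo `n` -/

/-- `α ^ z` for an exponent `z` modulo `n`. -/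
def rootPow {E : Type*} [Field E] {n : ℕ} (α : E) (z : ZMod n) : E := α ^ z.val

section RootPow

variable {E : Type*} [Field E] {n : ℕ} {α : E}

theorem rootPow_natCast (hα : IsPrimitiveRoot α n) (k : ℕ) : rootPow α (k : ZMod n) = α ^ k := by
  rw [rootPow, ZMod.val_natCast, hα.eq_orderOf, pow_mod_orderOf]

theorem rootPow_zero (hα : IsPrimitiveRoot α n) : rootPow α (0 : ZMod n) = 1 := by
  simpa using rootPow_natCast hα 0

theorem rootPow_add [NeZero n] (hα : IsPrimitiveRoot α n) (z w : ZMod n) :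
    rootPow α (z + w) = rootPow α z * rootPow α w := by
  have h := rootPow_natCast hα (z.val + w.val)
  rw [Nat.cast_add, ZMod.natCast_zmod_val, ZMod.natCast_zmod_val] at h
  rw [h, pow_add, rootPow, rootPow]

theorem rootPow_mul_natCast [NeZero n] (hα : IsPrimitiveRoot α n) (z : ZMod n) (k : ℕ) :
    rootPow α (z * (k : ZMod n)) = rootPow α z ^ k := by
  have h := rootPow_natCast hα (z.val * k)
  rw [Nat.cast_mul, ZMod.natCast_zmod_val] at h
  rw [h, pow_mul, rootPow]

theorem rootPow_pow_n (hα : IsPrimitiveRoot α n) (z : ZMod n) : rootPow α z ^ n = 1 := by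
  rw [rootPow, ← pow_mul, mul_comm, pow_mul, hα.pow_eq_one, one_pow]

theorem rootPow_injective [NeZero n] (hα : IsPrimitiveRoot α n) :
    Function.Injective (rootPow α : ZMod n → E) := fun z w h =>
  ZMod.val_injective n (hα.pow_inj (ZMod.val_lt z) (ZMod.val_lt w) h)

theorem rootPow_ne_zero [NeZero n] (hα : IsPrimitiveRoot α n) (z : ZMod n) : rootPow α z ≠ 0 :=
  pow_ne_zero _ (hα.ne_zero (NeZero.ne n))

theorem exists_rootPow_eq [NeZero n] (hα : IsPrimitiveRoot α n) {ζ : E} (h : ζ ^ n = 1) :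
    ∃ z : ZMod n, rootPow α z = ζ := by
  obtain ⟨i, -, rfl⟩ := hα.eq_pow_of_pow_eq_one h
  exact ⟨i, rootPow_natCast hα i⟩

end RootPow

/-! ### Cyclotomic cosets -/

section Coset

variable {q n : ℕ}

theorem self_mem_qCoset (x : ZMod n) : x ∈ qCoset q n x := ⟨0, by simp⟩

theorem mul_mem_qCoset {x z : ZMod n} (h : z ∈ qCoset q n x) : z * q ∈ qCoset q n x := by
  obtain ⟨k, rfl⟩ := h
  exact ⟨k + 1, by simp only [pow_succ, mul_assoc]⟩

theorem mul_pow_mem_qCoset {x z : ZMod n} (h : z ∈ qCoset q n x) (k : ℕ) :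
    z * (q : ZMod n) ^ k ∈ qCoset q n x := by
  obtain ⟨l, rfl⟩ := h
  exact ⟨l + k, by simp only [pow_add, mul_assoc]⟩

theorem qCoset_eq_of_mem [NeZero n] (hqn : q.Coprime n) {x z : ZMod n} (h : z ∈ qCoset q n x) :
    qCoset q n z = qCoset q n x := by
  obtain ⟨k, rfl⟩ := h
  have hq : (q : ZMod n) ^ n.totient = 1 := by
    have := congrArg Units.val (ZMod.pow_totient (ZMod.unitOfCoprime q hqn))
    rwa [Units.val_pow_eq_pow_val, ZMod.coe_unitOfCoprime, Units.val_one] at this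
  have hk : 1 ≤ n.totient := Nat.totient_pos.2 (NeZero.pos n)
  ext w
  constructor
  · rintro ⟨l, rfl⟩
    exact ⟨k + l, by simp only [pow_add, mul_assoc]⟩
  · rintro ⟨l, rfl⟩
    -- Since `q^φ(n) = 1`, the power `q^(k(φ(n) - 1))` is the inverse of `q^k`.
    refine ⟨k * (n.totient - 1) + l, ?_⟩
    have : k + (k * (n.totient - 1) + l) = n.totient * k + l := by
      obtain ⟨t, ht⟩ := Nat.exists_eq_add_of_le hk
      rw [ht, Nat.add_sub_cancel_left]
      ring
    simp only [mul_assoc, ← pow_add]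
    rw [this, pow_add, pow_mul, hq, one_pow, one_mul]

theorem neg_mem_qCoset_neg {x z : ZMod n} (h : z ∈ qCoset q n x) : -z ∈ qCoset q n (-x) := by
  obtain ⟨k, rfl⟩ := h
  exact ⟨k, by simp⟩

theorem qCoset_neg (x : ZMod n) : qCoset q n (-x) = Neg.neg '' qCoset q n x := by
  ext z
  constructor
  · intro h
    exact ⟨-z, by simpa using neg_mem_qCoset_neg h, neg_neg z⟩
  · rintro ⟨w, hw, rfl⟩
    exact neg_mem_qCoset_neg hw

theorem disjoint_qCoset_neg [NeZero n] (hqn : q.Coprime n) {x : ZMod n}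
    (hne : qCoset q n x ≠ qCoset q n (-x)) : Disjoint (qCoset q n x) (qCoset q n (-x)) :=
  Set.disjoint_left.2 fun _ h h' =>
    hne ((qCoset_eq_of_mem hqn h).symm.trans (qCoset_eq_of_mem hqn h'))

/-- Negation makes the two disjoint cosets equinumerous. The inequality is strict because `0 = -0`
would lie in both cosets if it lay in either. -/
theorem two_mul_ncard_qCoset_lt [NeZero n] (hqn : q.Coprime n) {x : ZMod n}
    (hne : qCoset q n x ≠ qCoset q n (-x)) : 2 * (qCoset q n x).ncard < n := by
  have hd := disjoint_qCoset_neg hqn hne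
  have hcard : (qCoset q n (-x)).ncard = (qCoset q n x).ncard := by
    rw [qCoset_neg, Set.ncard_image_of_injective _ neg_injective]
  have hun := Set.ncard_union_eq hd (Set.toFinite _) (Set.toFinite _)
  have h0 : (0 : ZMod n) ∉ qCoset q n x ∪ qCoset q n (-x) := by
    have key : ∀ y : ZMod n, (0 : ZMod n) ∈ qCoset q n y → qCoset q n y = qCoset q n 0 :=
      fun y hy => (qCoset_eq_of_mem hqn hy).symm
    have h : (0 : ZMod n) ∉ qCoset q n x := fun h => by
      have h' := neg_mem_qCoset_neg h
      rw [neg_zero] at h'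
      exact Set.disjoint_left.1 hd h h'
    rintro (h1 | h1)
    · exact h h1
    · apply h
      simpa using neg_mem_qCoset_neg h1
  have hlt : (qCoset q n x ∪ qCoset q n (-x)).ncard < (Set.univ : Set (ZMod n)).ncard :=
    Set.ncard_lt_ncard (Set.ssubset_univ_iff.2 fun h => h0 (h ▸ Set.mem_univ _)) (Set.toFinite _)
  rw [Set.ncard_univ, Nat.card_zmod] at hlt
  omega

theorem isUnit_pow_sub_one {k : ℕ} (hq : 1 ≤ q) (h : (q ^ k - 1).Coprime n) :
    IsUnit ((q : ZMod n) ^ k - 1) := by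
  have := (ZMod.isUnit_iff_coprime (q ^ k - 1) n).2 h
  rwa [Nat.cast_sub (Nat.one_le_pow _ _ hq), Nat.cast_pow, Nat.cast_one] at this

/-- Each step from `y + i` to `y + i + 1` is multiplication by `q^{a_{i+1}}`, so it stays in the
coset. -/
theorem hasConsecutive_qCoset [NeZero n] {r : ℕ} {a : ℕ → ℕ} (hq : 1 ≤ q)
    (hgcd : ∀ i, 1 ≤ i → i ≤ r → Nat.gcd (q ^ a i - 1) n = 1)
    (ht : ∀ j, 2 ≤ j → j ≤ r → tParam q n a j = 0) :
    HasConsecutive (r + 1) (qCoset q n ((q : ZMod n) ^ a 1 - 1)⁻¹) := by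
  refine ⟨((q : ZMod n) ^ a 1 - 1)⁻¹, fun i hi => ?_⟩
  induction i with
  | zero => simpa using self_mem_qCoset _
  | succ i ih =>
    have hu := isUnit_pow_sub_one hq (hgcd (i + 1) (by omega) (by omega))
    have h := mul_pow_mem_qCoset (ih (by omega)) (a (i + 1))
    convert h using 1
    -- For `i = 0` this is trivial; for `i ≥ 1` it is the vanishing of `t_{i+1}`.
    have key : ((q : ZMod n) ^ a 1 - 1)⁻¹ =
        (((i : ZMod n) + 1) - i * (q : ZMod n) ^ a (i + 1)) *
          ((q : ZMod n) ^ a (i + 1) - 1)⁻¹ := by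
      rcases Nat.eq_zero_or_pos i with rfl | hpos
      · simp
      · have := ht (i + 1) (by omega) (by omega)
        rw [tParam, sub_eq_zero] at this
        rw [← this]
        push_cast
        ring
    have hinv := ZMod.mul_inv_of_unit _ hu
    rw [key]
    generalize (q : ZMod n) ^ a (i + 1) = Q at *
    push_cast
    linear_combination (-(i + 1 : ZMod n) + i * Q) * hinv

end Coset

/-! ### Words of a code and their spectrum -/

section Spectrum

variable {F E : Type*} [Field F] [Field E] [Algebra F E] {n : ℕ}

/-- The value at `α ^ z` of the polynomial with coefficient vector `c`. -/
def spectrumAt (α : E) (c : Fin n → F) (z : ZMod n) : E :=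
  ∑ i, algebraMap F E (c i) * rootPow α (z * ((i : ℕ) : ZMod n))

/-- The polynomial with coefficient vector `c`. -/
def vecToPoly (c : Fin n → F) : F[X] := ∑ i, C (c i) * X ^ (i : ℕ)

theorem vecToRing_eq_mk (c : Fin n → F) :
    vecToRing F n c = CyclicRing.mk F n (vecToPoly c) := by
  rw [vecToRing, Fintype.linearCombination_apply, vecToPoly, map_sum]
  refine Finset.sum_congr rfl fun i _ => ?_
  rw [← smul_eq_C_mul]
  rfl

theorem exists_vecToRing_eq_mk (hn : n ≠ 0) (p : F[X]) :
    ∃ c : Fin n → F, vecToRing F n c = CyclicRing.mk F n p := by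
  have hm : (X ^ n - 1 : F[X]).Monic := by simpa using monic_X_pow_sub_C (1 : F) hn
  refine ⟨fun i => (p %ₘ (X ^ n - 1)).coeff i, ?_⟩
  have hdeg : (p %ₘ (X ^ n - 1)).natDegree < n := by
    have := natDegree_modByMonic_lt p hm (fun h => hn (by
      have := natDegree_X_pow_sub_C (n := n) (r := (1 : F))
      rw [C_1, h] at this
      simpa using this.symm))
    rwa [← C_1, natDegree_X_pow_sub_C, C_1] at this
  have hpoly : vecToPoly (fun i : Fin n => (p %ₘ (X ^ n - 1)).coeff i) = p %ₘ (X ^ n - 1) := by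
    conv_rhs => rw [as_sum_range_C_mul_X_pow' _ hdeg]
    exact Fin.sum_univ_eq_sum_range
      (fun i => C ((p %ₘ (X ^ n - 1)).coeff i) * (X : F[X]) ^ i) n
  rw [vecToRing_eq_mk, hpoly, Ideal.Quotient.eq, Ideal.mem_span_singleton]
  exact ⟨-(p /ₘ (X ^ n - 1)), by linear_combination modByMonic_add_div p (X ^ n - 1)⟩

theorem spectrumAt_eq_aeval [NeZero n] {α : E} (hα : IsPrimitiveRoot α n) (c : Fin n → F)
    (z : ZMod n) : spectrumAt α c z = aeval (rootPow α z) (vecToPoly c) := by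
  simp [spectrumAt, vecToPoly, rootPow_mul_natCast hα]

theorem aeval_eq_of_mk_eq {α : E} (hα : IsPrimitiveRoot α n) {p p' : F[X]}
    (h : CyclicRing.mk F n p = CyclicRing.mk F n p') (z : ZMod n) :
    aeval (rootPow α z) p = aeval (rootPow α z) p' := by
  rw [Ideal.Quotient.eq, Ideal.mem_span_singleton] at h
  obtain ⟨s, hs⟩ := h
  rw [← sub_eq_zero, ← map_sub, hs, map_mul, map_sub, map_pow, aeval_X, rootPow_pow_n hα]
  simp

/-- A cyclic code is determined by its defining set. -/
theorem mk_mem_iff [NeZero n] {α : E} (hα : IsPrimitiveRoot α n)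
    (I : Ideal (CyclicRing F n)) (p : F[X]) :
    CyclicRing.mk F n p ∈ I ↔ ∀ z ∈ definingSet α I, aeval (rootPow α z) p = 0 := by
  refine ⟨fun hp z hz => hz p hp, fun hp => ?_⟩
  let J := I.comap (CyclicRing.mk F n)
  obtain ⟨g, hg⟩ := (IsPrincipalIdealRing.principal J).principal
  have hJ : ∀ f : F[X], CyclicRing.mk F n f ∈ I ↔ g ∣ f := fun f => by
    rw [← Ideal.mem_span_singleton, ← Ideal.mem_comap]
    exact iff_of_eq (congrArg (f ∈ ·) hg)
  have hgn : g ∣ X ^ n - 1 := by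
    rw [← hJ, (Ideal.Quotient.eq_zero_iff_mem).2 (Ideal.mem_span_singleton_self _)]
    exact I.zero_mem
  have hgn' : g.map (algebraMap F E) ∣ X ^ n - 1 := by
    simpa using Polynomial.map_dvd (algebraMap F E) hgn
  have hne : (X ^ n - 1 : E[X]) ≠ 0 := by
    simpa using X_pow_sub_C_ne_zero (NeZero.pos n) (1 : E)
  have hprod := X_pow_sub_one_eq_prod (NeZero.pos n) hα
  have hsplit : (g.map (algebraMap F E)).Splits := by
    refine Splits.of_dvd ?_ hne hgn'
    rw [hprod]
    exact Splits.prod fun ζ _ => Splits.X_sub_C ζ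
  have hnodup : (g.map (algebraMap F E)).roots.Nodup := by
    refine Multiset.nodup_of_le (roots.le_of_dvd hne hgn') ?_
    rw [hprod, roots_prod_X_sub_C]
    exact Finset.nodup _
  have hg0 : g.map (algebraMap F E) ≠ 0 := ne_zero_of_dvd_ne_zero hne hgn'
  -- Divisibility by the generator `g` may be tested over `E`. There `g` splits with simple roots,
  -- so it suffices that each root of `g` is a root of `p`; these roots are powers of `α` with
  -- exponents in the defining set.
  rw [hJ, ← map_dvd_map' (algebraMap F E)]
  by_cases hp0 : p = 0
  · simp [hp0]
  refine hsplit.dvd_of_roots_le_roots hg0 ((Multiset.le_iff_subset hnodup).2 fun ζ hζ => ?_)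
  have hgζ : (g.map (algebraMap F E)).IsRoot ζ := isRoot_of_mem_roots hζ
  have hζn : ζ ^ n = 1 := by
    have := hgζ.dvd hgn'
    simpa [IsRoot, sub_eq_zero] using this
  obtain ⟨z, rfl⟩ := exists_rootPow_eq hα hζn
  have hz : z ∈ definingSet α I := fun f hf => by
    have := hgζ.dvd (Polynomial.map_dvd (algebraMap F E) ((hJ f).1 hf))
    rwa [IsRoot, eval_map_algebraMap] at this
  rw [mem_roots (by simpa using hp0), IsRoot, eval_map_algebraMap]
  exact hp z hz

theorem mem_toLinearCode_iff [NeZero n] {α : E} (hα : IsPrimitiveRoot α n)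
    {I : Ideal (CyclicRing F n)} {c : Fin n → F} :
    c ∈ toLinearCode I ↔ ∀ z ∈ definingSet α I, spectrumAt α c z = 0 := by
  have : c ∈ toLinearCode I ↔ vecToRing F n c ∈ I := Iff.rfl
  rw [this, vecToRing_eq_mk, mk_mem_iff hα]
  simp only [spectrumAt_eq_aeval hα]

theorem exists_mem_toLinearCode_spectrumAt_ne_zero [NeZero n] {α : E}
    (hα : IsPrimitiveRoot α n) {I : Ideal (CyclicRing F n)} {z : ZMod n}
    (hz : z ∉ definingSet α I) : ∃ c ∈ toLinearCode I, spectrumAt α c z ≠ 0 := by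
  have : ¬ ∀ p : F[X], CyclicRing.mk F n p ∈ I → aeval (rootPow α z) p = 0 := hz
  push Not at this
  obtain ⟨p, hp, hpz⟩ := this
  obtain ⟨c, hc⟩ := exists_vecToRing_eq_mk (NeZero.ne n) p
  refine ⟨c, ?_, ?_⟩
  · change vecToRing F n c ∈ I
    rwa [hc]
  · rw [spectrumAt_eq_aeval hα]
    rw [vecToRing_eq_mk] at hc
    rwa [aeval_eq_of_mk_eq hα hc]

theorem natCast_val_add [NeZero n] (i k : Fin n) :
    (((i + k : Fin n) : ℕ) : ZMod n) = ((i : ℕ) : ZMod n) + ((k : ℕ) : ZMod n) := by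
  rw [Fin.val_add, ZMod.natCast_mod, Nat.cast_add]

/-- Addition in `Fin n` is cyclic, so this is a reindexing: shifting a word only multiplies its
value at `α^z` by a nonzero factor. -/
theorem sum_rootPow_mul_shift [NeZero n] {α : E} (hα : IsPrimitiveRoot α n) (c : Fin n → F)
    (z : ZMod n) (k : Fin n) :
    (∑ i, algebraMap F E (c (i + k)) *
      (rootPow α (z * ((i : ℕ) : ZMod n)) * rootPow α (z * ((k : ℕ) : ZMod n)))) =
      spectrumAt α c z := by
  refine (Finset.sum_congr rfl fun i _ => ?_).trans (Equiv.sum_comp (Equiv.addRight k)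
    fun i => algebraMap F E (c i) * rootPow α (z * ((i : ℕ) : ZMod n)))
  rw [Equiv.coe_addRight, natCast_val_add, mul_add, rootPow_add hα]

theorem spectrumAt_shift_eq_zero [NeZero n] {α : E} (hα : IsPrimitiveRoot α n) {c : Fin n → F}
    {z : ZMod n} (h : spectrumAt α c z = 0) (k : Fin n) :
    spectrumAt α (fun i => c (i + k)) z = 0 := by
  rw [← sum_rootPow_mul_shift hα c z k] at h
  simp only [← mul_assoc] at h
  rw [← Finset.sum_mul] at h
  exact (mul_eq_zero.1 h).resolve_right (rootPow_ne_zero hα _)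

/-- The Euclidean dual of a cyclic code vanishes at the negatives of the nonzeros. -/
theorem spectrumAt_eq_zero_of_mem_euclideanDual [NeZero n] {α : E} (hα : IsPrimitiveRoot α n)
    {I : Ideal (CyclicRing F n)} {y : Fin n → F} (hy : y ∈ euclideanDual (toLinearCode I))
    {z : ZMod n} (hz : -z ∉ definingSet α I) : spectrumAt α y z = 0 := by
  obtain ⟨c, hc, hcz⟩ := exists_mem_toLinearCode_spectrumAt_ne_zero hα hz
  have hshift : ∀ k : Fin n, ∑ i, c (i + k) * y i = 0 := fun k =>
    hy _ ((mem_toLinearCode_iff hα).2 fun w hw =>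
      spectrumAt_shift_eq_zero hα ((mem_toLinearCode_iff hα).1 hc w hw) k)
  -- Grouping the product by the shift `k`, the coefficient is the dot product of `y` with the
  -- `k`-th cyclic shift of `c`, which is again a codeword.
  have key : spectrumAt α y z * spectrumAt α c (-z) = 0 := by
    calc spectrumAt α y z * spectrumAt α c (-z)
        = ∑ i, ∑ k : Fin n, algebraMap F E (c (i + k) * y i) *
            rootPow α (-z * ((k : ℕ) : ZMod n)) := by
          rw [spectrumAt, Finset.sum_mul]
          refine Finset.sum_congr rfl fun i _ => ?_
          rw [← sum_rootPow_mul_shift hα c (-z) i, Finset.mul_sum]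
          refine Finset.sum_congr rfl fun k _ => ?_
          have h1 : rootPow α (z * ((i : ℕ) : ZMod n)) *
              rootPow α (-z * ((i : ℕ) : ZMod n)) = 1 := by
            rw [← rootPow_add hα, neg_mul, add_neg_cancel, rootPow_zero hα]
          rw [map_mul, add_comm k i]
          linear_combination algebraMap F E (y i) * algebraMap F E (c (i + k)) *
            rootPow α (-z * ((k : ℕ) : ZMod n)) * h1
      _ = 0 := by
          rw [Finset.sum_comm]
          refine Finset.sum_eq_zero fun k _ => ?_
          rw [← Finset.sum_mul, ← map_sum, hshift k, map_zero, zero_mul]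
  exact (mul_eq_zero.1 key).resolve_right hcz

/-- For `z ∈ C_x`, the exponent `-z` lies in `C_{-x}`, hence outside the defining set `C_x`. -/
theorem euclideanDual_toLinearCode_le [NeZero n] {α : E} (hα : IsPrimitiveRoot α n)
    {q : ℕ} (hqn : q.Coprime n) {I : Ideal (CyclicRing F n)} {x : ZMod n}
    (hI : definingSet α I = qCoset q n x) (hne : qCoset q n x ≠ qCoset q n (-x)) :
    euclideanDual (toLinearCode I) ≤ toLinearCode I := by
  intro y hy
  rw [mem_toLinearCode_iff hα, hI]
  intro z hz
  refine spectrumAt_eq_zero_of_mem_euclideanDual hα hy fun hz' => ?_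
  rw [hI] at hz'
  exact Set.disjoint_left.1 (disjoint_qCoset_neg hqn hne) hz'
    (neg_mem_qCoset_neg hz)

/-- The BCH bound. -/
theorem eq_zero_of_spectrumAt_consecutive [NeZero n] {α : E} (hα : IsPrimitiveRoot α n)
    {c : Fin n → F} {b : ZMod n} {l : ℕ} (hc : ∀ k < l, spectrumAt α c (b + (k : ZMod n)) = 0)
    {S : Set (Fin n)} (hS : S.ncard ≤ l) (hcS : ∀ i ∉ S, c i = 0) : c = 0 := by
  classical
  by_contra hne
  obtain ⟨i₀, hi₀⟩ := Function.ne_iff.1 hne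
  have hi₀S : i₀ ∈ S := by
    by_contra h
    exact hi₀ (hcS i₀ h)
  -- `P` kills every position of `S` except `i₀`, and leaving one out makes its degree less than
  -- `l`. The sum of `c_i α^(b i) P(α^i)` is then a combination of the `l` vanishing values, while
  -- only its `i₀` term survives.
  let T : Finset (Fin n) := S.toFinset.erase i₀
  let P : E[X] := ∏ j ∈ T, (X - C (α ^ (j : ℕ)))
  have hdeg : P.natDegree < l := by
    have h1 : P.natDegree = T.card := natDegree_finsetProd_X_sub_C_eq_card T _
    have h2 : T.card + 1 = S.ncard := by
      rw [Set.ncard_eq_toFinset_card']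
      exact Finset.card_erase_add_one (Set.mem_toFinset.2 hi₀S)
    omega
  have hsum : ∑ i, algebraMap F E (c i) * rootPow α (b * ((i : ℕ) : ZMod n)) *
      P.eval (α ^ (i : ℕ)) = 0 := by
    simp only [eval_eq_sum_range' hdeg, Finset.mul_sum]
    rw [Finset.sum_comm]
    refine Finset.sum_eq_zero fun k hk => ?_
    have := hc k (Finset.mem_range.1 hk)
    rw [spectrumAt] at this
    rw [← mul_zero (P.coeff k), ← this, Finset.mul_sum]
    refine Finset.sum_congr rfl fun i _ => ?_
    have h1 : rootPow α ((k : ZMod n) * ((i : ℕ) : ZMod n)) = (α ^ (i : ℕ)) ^ k := by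
      rw [← Nat.cast_mul, rootPow_natCast hα, mul_comm, pow_mul]
    rw [add_mul, rootPow_add hα, h1]
    ring
  rw [Finset.sum_eq_single i₀] at hsum
  · rw [mul_eq_zero, mul_eq_zero] at hsum
    rcases hsum with (h | h) | h
    · exact hi₀ (by simpa using h)
    · exact rootPow_ne_zero hα _ h
    · rw [eval_prod, Finset.prod_eq_zero_iff] at h
      obtain ⟨j, hj, hj0⟩ := h
      rw [eval_sub, eval_X, eval_C, sub_eq_zero] at hj0
      exact Finset.ne_of_mem_erase hj
        (Fin.ext (hα.pow_inj i₀.2 j.2 hj0)).symm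
  · intro i _ hi
    by_cases hiS : i ∈ S
    · have : P.eval (α ^ (i : ℕ)) = 0 := by
        rw [eval_prod]
        exact Finset.prod_eq_zero
          (Finset.mem_erase.2 ⟨hi, Set.mem_toFinset.2 hiS⟩) (by simp)
      rw [this, mul_zero]
    · simp [hcS i hiS]
  · simp

theorem isIntegral_rootPow {α : E} (hα : IsPrimitiveRoot α n) [NeZero n] (x : ZMod n) :
    IsIntegral F (rootPow α x) :=
  ⟨X ^ n - C 1, monic_X_pow_sub_C 1 (NeZero.ne n), by simp [rootPow_pow_n hα]⟩

end Spectrum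

/-! ### Euclidean duals -/

section Dual

variable {F : Type*} [Field F] {n : ℕ}

/-- The dot product carries the Euclidean dual to the dual annihilator. -/
theorem finrank_euclideanDual (C : Submodule F (Fin n → F)) :
    Module.finrank F (euclideanDual C) = n - Module.finrank F C := by
  have h : (euclideanDual C).map (dotProductEquiv F (Fin n) : (Fin n → F) →ₗ[F] _) =
      C.dualAnnihilator := by
    ext f
    obtain ⟨y, rfl⟩ := (dotProductEquiv F (Fin n)).surjective f
    rw [Submodule.mem_dualAnnihilator, Submodule.mem_map_equiv, LinearEquiv.symm_apply_apply]
    refine forall₂_congr fun c _ => ?_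
    simp [dotProduct, mul_comm]
  have h1 := LinearEquiv.finrank_map_eq (dotProductEquiv F (Fin n)) (euclideanDual C)
  rw [h] at h1
  have h2 := Subspace.finrank_add_finrank_dualAnnihilator_eq C
  rw [Module.finrank_fin_fun] at h2
  omega

/-- If no nonzero word of `C` is supported in `S`, the dual code restricts onto `F ^ S`. -/
theorem exists_mem_euclideanDual_eqOn {C : Submodule F (Fin n → F)} {S : Set (Fin n)}
    (hS : ∀ c ∈ C, (∀ i ∉ S, c i = 0) → c = 0) (v : Fin n → F) :
    ∃ w ∈ euclideanDual C, ∀ i ∈ S, w i = v i := by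
  classical
  -- Erasing the coordinates in `S` is injective on `C`, so the functional `c ↦ ∑_{i ∈ S} v_i c_i`
  -- factors through it. It is therefore the dot product of some `y` with the coordinates outside
  -- `S`; the witness is `v` on `S` and `-y` elsewhere.
  let f : C →ₗ[F] (Fin n → F) :=
    (LinearMap.pi fun i => if i ∈ S then 0 else LinearMap.proj i) ∘ₗ C.subtype
  have hf : ∀ (c : C) (i : Fin n), f c i = if i ∈ S then 0 else (c : Fin n → F) i := by
    intro c i
    simp only [f, LinearMap.comp_apply, LinearMap.pi_apply]
    split_ifs <;> simp
  have hker : LinearMap.ker f = ⊥ := by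
    rw [LinearMap.ker_eq_bot']
    intro c hc
    refine Subtype.ext (hS c c.2 fun i hi => ?_)
    simpa [hf, hi] using congrFun hc i
  obtain ⟨g, hg⟩ := f.exists_leftInverse_of_injective hker
  let φ : C →ₗ[F] F :=
    (∑ i, (if i ∈ S then v i else 0) • LinearMap.proj i : (Fin n → F) →ₗ[F] F) ∘ₗ C.subtype
  obtain ⟨y, hy⟩ := (dotProductEquiv F (Fin n)).surjective (φ ∘ₗ g)
  refine ⟨fun i => if i ∈ S then v i else -y i, fun c hc => ?_, fun i hi => if_pos hi⟩
  have h1 : y ⬝ᵥ f ⟨c, hc⟩ = φ ⟨c, hc⟩ := by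
    have hgf : g (f ⟨c, hc⟩) = ⟨c, hc⟩ := LinearMap.congr_fun hg ⟨c, hc⟩
    simpa only [LinearMap.comp_apply, hgf, dotProductEquiv_apply_apply] using
      LinearMap.congr_fun hy (f ⟨c, hc⟩)
  have h2 : φ ⟨c, hc⟩ = ∑ i, (if i ∈ S then v i else 0) * c i := by
    simp only [φ, LinearMap.comp_apply, LinearMap.sum_apply, LinearMap.smul_apply,
      LinearMap.proj_apply, Submodule.subtype_apply, smul_eq_mul]
  rw [h2, dotProduct, ← sub_eq_zero, ← Finset.sum_sub_distrib] at h1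
  rw [← neg_eq_zero, ← Finset.sum_neg_distrib, ← h1]
  refine Finset.sum_congr rfl fun i _ => ?_
  by_cases hi : i ∈ S
  · simp [hf, hi, mul_comm]
  · simp [hf, hi, mul_comm]

end Dual

/-! ### Coset states and the CSS construction -/

section CSS

theorem tensorOp_diag_congr {ι : Type*} [DecidableEq ι] {n : ℕ} {A : Fin n → Matrix ι ι ℂ}
    {u v : Fin n → ι}
    (h : ∀ i, A i ≠ 1 → u i = v i) : tensorOp A u u = tensorOp A v v := by
  simp only [tensorOp, Matrix.of_apply]
  refine Finset.prod_congr rfl fun i _ => ?_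
  by_cases hA : A i = 1
  · simp [hA]
  · rw [h i hA]

theorem tensorOp_eq_zero {ι : Type*} [DecidableEq ι] {n : ℕ} {A : Fin n → Matrix ι ι ℂ}
    {u v : Fin n → ι} {i : Fin n}
    (hA : A i = 1) (h : u i ≠ v i) : tensorOp A u v = 0 :=
  Finset.prod_eq_zero (Finset.mem_univ i) (by rw [hA, Matrix.one_apply_ne h])

variable {F : Type*} [Field F] {n : ℕ}

open scoped Classical in
theorem cosetState_apply (D : Submodule F (Fin n → F)) (v u : Fin n → F) :
    cosetState D v u = if u - v ∈ D then 1 else 0 := by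
  simp [cosetState, Set.indicator_apply]

theorem cosetState_apply_congr {D : Submodule F (Fin n → F)} {v w u u' : Fin n → F}
    (h : u - v ∈ D ↔ u' - w ∈ D) : cosetState D v u = cosetState D w u' := by
  rw [cosetState_apply, cosetState_apply]
  by_cases h' : u' - w ∈ D
  · rw [if_pos (h.2 h'), if_pos h']
  · rw [if_neg (mt h.1 h'), if_neg h']

theorem cosetState_eq_of_sub_mem {D : Submodule F (Fin n → F)} {v w : Fin n → F}
    (h : v - w ∈ D) : cosetState D v = cosetState D w := by
  ext u
  refine cosetState_apply_congr ?_
  rw [← D.add_mem_iff_left (x := u - v) h, sub_add_sub_cancel]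

theorem cosetState_mul_eq_zero {D : Submodule F (Fin n → F)} {v w : Fin n → F}
    (h : v - w ∉ D) (u : Fin n → F) : cosetState D v u * cosetState D w u = 0 := by
  rw [cosetState_apply, cosetState_apply]
  by_cases h1 : u - v ∈ D
  · by_cases h2 : u - w ∈ D
    · exact absurd (by simpa using D.sub_mem h2 h1) h
    · simp [h2]
  · simp [h1]

theorem cosetState_ne_zero (D : Submodule F (Fin n → F)) (v : Fin n → F) :
    cosetState D v ≠ 0 := by
  intro h
  have := congrArg (fun φ : QuditSpace F n => φ v) h
  simp [cosetState_apply] at this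

variable [Fintype F]

theorem inner_cosetState (D : Submodule F (Fin n → F)) (v w : Fin n → F) :
    inner ℂ (cosetState D v) (cosetState D w) =
      ∑ u, cosetState D v u * cosetState D w u := by
  rw [PiLp.inner_apply]
  refine Finset.sum_congr rfl fun u _ => ?_
  rw [cosetState_apply, cosetState_apply]
  split_ifs <;> simp


/-- States of distinct cosets have disjoint supports, so they form an orthogonal basis indexed by `C
/ C^⊥`. -/
theorem finrank_cssCode {C : Submodule F (Fin n → F)} (hC : euclideanDual C ≤ C) :
    Module.finrank ℂ (cssCode C) =
      Fintype.card F ^ (Module.finrank F C - Module.finrank F (euclideanDual C)) := by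
  classical
  set D := euclideanDual C with hD
  let b : (C ⧸ D.submoduleOf C) → QuditSpace F n := fun t => cosetState D (t.out : C)
  have hmk : ∀ c d : C, (Submodule.Quotient.mk c : C ⧸ D.submoduleOf C) =
      Submodule.Quotient.mk d ↔ (c : Fin n → F) - d ∈ D := by
    intro c d
    rw [Submodule.Quotient.eq]
    rfl
  have hrange : Set.range b = cosetState D '' (C : Set (Fin n → F)) := by
    ext φ
    constructor
    · rintro ⟨t, rfl⟩
      exact ⟨_, t.out.2, rfl⟩
    · rintro ⟨v, hv, rfl⟩
      refine ⟨Submodule.Quotient.mk ⟨v, hv⟩, cosetState_eq_of_sub_mem ?_⟩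
      refine (hmk _ ⟨v, hv⟩).1 ?_
      exact Quotient.out_eq' (s₁ := (D.submoduleOf C).quotientRel) _
  have hli : LinearIndependent ℂ b := by
    refine linearIndependent_of_ne_zero_of_inner_eq_zero (fun _ => cosetState_ne_zero _ _) ?_
    intro s t hst
    change inner ℂ (cosetState D _) (cosetState D _) = 0
    rw [inner_cosetState]
    refine Finset.sum_eq_zero fun u _ => cosetState_mul_eq_zero (fun h => hst ?_) u
    have := (hmk _ _).2 h
    have e : ∀ t : C ⧸ D.submoduleOf C, Submodule.Quotient.mk t.out = t := fun t =>
      Quotient.out_eq' (s₁ := (D.submoduleOf C).quotientRel) t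
    rwa [e, e] at this
  have : Fintype (C ⧸ D.submoduleOf C) := Fintype.ofFinite _
  rw [cssCode, ← hrange, finrank_span_eq_card hli, Module.card_eq_pow_finrank (K := F)]
  congr 1
  have h1 := Submodule.finrank_quotient_add_finrank (D.submoduleOf C)
  have h2 := (Submodule.submoduleOfEquivOfLe hC).finrank_eq
  omega

variable [DecidableEq F]

theorem inner_cosetState_tensorOp (D : Submodule F (Fin n → F)) (A : Fin n → Matrix F F ℂ)
    (v w : Fin n → F) :
    inner ℂ (cosetState D v) (Matrix.toEuclideanLin (tensorOp A) (cosetState D w)) =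
      ∑ u, ∑ u', cosetState D v u * (tensorOp A u u' * cosetState D w u') := by
  rw [PiLp.inner_apply]
  refine Finset.sum_congr rfl fun u _ => ?_
  rw [← Finset.mul_sum]
  have : Matrix.toEuclideanLin (tensorOp A) (cosetState D w) u =
      ∑ u', tensorOp A u u' * cosetState D w u' := by
    simp [Matrix.toLpLin_apply, Matrix.mulVec, dotProduct]
  rw [this, cosetState_apply D v u]
  split_ifs <;> simp

/-- Choose `w ∈ C^⊥` equal to `v` on the error positions. Translation by `v - w` maps `C^⊥` onto `v
+ C^⊥` without changing any coordinate the error acts on. -/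
theorem sum_cosetState_mul_diag {C : Submodule F (Fin n → F)} {A : Fin n → Matrix F F ℂ}
    (hS : ∀ c ∈ C, (∀ i, A i = 1 → c i = 0) → c = 0) (v : Fin n → F) :
    ∑ u, cosetState (euclideanDual C) v u * tensorOp A u u =
      ∑ u, cosetState (euclideanDual C) 0 u * tensorOp A u u := by
  obtain ⟨w, hw, hwv⟩ := exists_mem_euclideanDual_eqOn (S := {i | A i ≠ 1})
    (fun c hc h => hS c hc fun i hi => h i (by simpa using hi)) v
  rw [← Equiv.sum_comp (Equiv.addRight (v - w))]
  refine Finset.sum_congr rfl fun u _ => ?_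
  have h1 : tensorOp A (u + (v - w)) (u + (v - w)) = tensorOp A u u :=
    tensorOp_diag_congr fun i hi => by simp [hwv i hi]
  have h2 : u + (v - w) - v ∈ euclideanDual C ↔ u - 0 ∈ euclideanDual C := by
    rw [← Submodule.sub_mem_iff_left (x := u - 0) _ hw]
    congr! 1
    abel
  rw [Equiv.coe_addRight, h1, cosetState_apply_congr h2]

/-- The Knill–Laflamme condition on the spanning states; the scalar is the average over `C^⊥` of the
diagonal entries of the error. -/
theorem inner_tensorOp_of_cosetState {C : Submodule F (Fin n → F)} (hC : euclideanDual C ≤ C)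
    {A : Fin n → Matrix F F ℂ} (hS : ∀ c ∈ C, (∀ i, A i = 1 → c i = 0) → c = 0)
    {v w : Fin n → F} (hv : v ∈ C) (hw : w ∈ C) :
    inner ℂ (cosetState (euclideanDual C) v)
        (Matrix.toEuclideanLin (tensorOp A) (cosetState (euclideanDual C) w)) =
      (∑ u, cosetState (euclideanDual C) 0 u * tensorOp A u u) /
        (∑ u, cosetState (euclideanDual C) 0 u) *
        inner ℂ (cosetState (euclideanDual C) v) (cosetState (euclideanDual C) w) := by
  set D := euclideanDual C with hD
  have hdiag : inner ℂ (cosetState D v) (Matrix.toEuclideanLin (tensorOp A) (cosetState D w)) =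
      ∑ u, cosetState D v u * cosetState D w u * tensorOp A u u := by
    rw [inner_cosetState_tensorOp]
    refine Finset.sum_congr rfl fun u _ => ?_
    rw [Finset.sum_eq_single u]
    · ring
    · intro u' _ hne
      -- A nonzero off-diagonal term would make `u' - u` a word of `C` supported on the error
      -- positions, hence zero.
      by_contra h
      have h1 : u - v ∈ D := by
        by_contra h'
        simp [cosetState_apply, h'] at h
      have h2 : u' - w ∈ D := by
        by_contra h'
        simp [cosetState_apply, h'] at h
      have h3 : u' - u ∈ C := by
        have : u' - u = (u' - w) - (u - v) + (w - v) := by abel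
        rw [this]
        exact C.add_mem (C.sub_mem (hC h2) (hC h1)) (C.sub_mem hw hv)
      refine hne (sub_eq_zero.1 (hS _ h3 fun i hi => ?_))
      by_contra h4
      have h5 : u i ≠ u' i := fun h5 => h4 (by simp [h5])
      simp [tensorOp_eq_zero hi h5] at h
    · simp
  rw [hdiag, inner_cosetState]
  by_cases hvw : v - w ∈ D
  · rw [← cosetState_eq_of_sub_mem hvw]
    have hsq : ∀ u, cosetState D v u * cosetState D v u = cosetState D v u := by
      intro u
      rw [cosetState_apply]
      split_ifs <;> simp
    simp only [hsq]
    rw [sum_cosetState_mul_diag hS v]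
    have hcard : ∑ u, cosetState D v u = ∑ u, cosetState D 0 u := by
      rw [← Equiv.sum_comp (Equiv.addRight v)]
      exact Finset.sum_congr rfl fun u _ => cosetState_apply_congr (by simp)
    have hne : ∑ u, cosetState D 0 u ≠ 0 := by
      classical
      simp only [cosetState_apply, Finset.sum_boole, ne_eq, Nat.cast_eq_zero,
        Finset.card_eq_zero]
      exact Finset.Nonempty.ne_empty ⟨0, by simp⟩
    rw [hcard, div_mul_cancel₀ _ hne]
  · simp [cosetState_mul_eq_zero hvw]

/-- The scalar depends only on the error, so sesquilinearity extends the identity from coset states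
to their span. -/
theorem detectsBelow_cssCode {C : Submodule F (Fin n → F)} (hC : euclideanDual C ≤ C) {d : ℕ}
    (hd : ∀ S : Set (Fin n), S.ncard < d → ∀ c ∈ C, (∀ i ∉ S, c i = 0) → c = 0) :
    DetectsBelow d (cssCode C) := by
  intro A hA
  have hS : ∀ c ∈ C, (∀ i, A i = 1 → c i = 0) → c = 0 := fun c hc h =>
    hd _ hA c hc fun i hi => h i (by simpa using hi)
  refine ⟨(∑ u, cosetState (euclideanDual C) 0 u * tensorOp A u u) /
    (∑ u, cosetState (euclideanDual C) 0 u), fun φ hφ ψ hψ => ?_⟩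
  refine Submodule.span_induction₂
    (p := fun φ ψ _ _ => inner ℂ φ (Matrix.toEuclideanLin (tensorOp A) ψ) = _ * inner ℂ φ ψ)
    ?_ ?_ ?_ ?_ ?_ ?_ ?_ hφ hψ
  · rintro _ _ ⟨v, hv, rfl⟩ ⟨w, hw, rfl⟩
    exact inner_tensorOp_of_cosetState hC hS hv hw
  · intro y _
    simp
  · intro x _
    simp
  · intro x y z _ _ _ h1 h2
    rw [inner_add_left, inner_add_left, h1, h2, mul_add]
  · intro x y z _ _ _ h1 h2
    rw [map_add, inner_add_right, inner_add_right, h1, h2, mul_add]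
  · intro r x y _ _ h
    rw [inner_smul_left, inner_smul_left, h]
    ring
  · intro r x y _ _ h
    rw [map_smul, inner_smul_right, inner_smul_right, h]
    ring

end CSS

/-! ### Minimal polynomials and cyclotomic cosets -/

section Minpoly

variable {F E : Type*} [Field F] [Fintype F] [Field E] [Algebra F E] {n q : ℕ}

/-- The elements of `F` already exhaust the roots of `X^|F| - X`. -/
theorem mem_range_algebraMap_of_pow_card_eq {a : E} (h : a ^ Fintype.card F = a) :
    a ∈ Set.range (algebraMap F E) := by
  have hmonic : (X ^ Fintype.card F - X : F[X]).Monic :=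
    monic_X_pow_sub (by simpa using Fintype.one_lt_card)
  have hprod : (∏ b : F, (X - C b)) = X ^ Fintype.card F - X := by
    have := prod_multiset_X_sub_C_of_monic_of_roots_card_eq hmonic (by
      rw [FiniteField.roots_X_pow_card_sub_X,
        FiniteField.X_pow_card_sub_X_natDegree_eq F Fintype.one_lt_card]
      rfl)
    rwa [FiniteField.roots_X_pow_card_sub_X] at this
  have h0 : aeval a (∏ b : F, (X - C b)) = 0 := by
    rw [hprod]
    simp [h]
  rw [map_prod, Finset.prod_eq_zero_iff] at h0
  obtain ⟨b, -, hb⟩ := h0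
  exact ⟨b, by
    rw [map_sub, aeval_X, aeval_C, sub_eq_zero] at hb
    exact hb.symm⟩

theorem aeval_pow_card (p : F[X]) (β : E) :
    aeval (β ^ Fintype.card F) p = aeval β p ^ Fintype.card F :=
  aeval_algHom_apply (FiniteField.frobeniusAlgHom F E) β p

theorem aeval_rootPow_eq_zero_of_mem_qCoset [NeZero n] {α : E} (hα : IsPrimitiveRoot α n)
    (hF : Fintype.card F = q) {p : F[X]} {x z : ZMod n} (hp : aeval (rootPow α x) p = 0)
    (hz : z ∈ qCoset q n x) : aeval (rootPow α z) p = 0 := by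
  obtain ⟨k, rfl⟩ := hz
  induction k with
  | zero => simpa using hp
  | succ k ih =>
    have : rootPow α (x * (q : ZMod n) ^ (k + 1)) =
        rootPow α (x * (q : ZMod n) ^ k) ^ Fintype.card F := by
      rw [hF, ← rootPow_mul_natCast hα, pow_succ, mul_assoc]
    simp only at ih ⊢
    rw [this, aeval_pow_card, ih, zero_pow Fintype.card_ne_zero]

/-- Frobenius sends `α^z` to `α^(zq)`, and multiplication by `q` permutes the coset. The product is
thus fixed by Frobenius and its coefficients lie in `F`. -/
theorem exists_map_eq_prod_qCoset [NeZero n] {α : E} (hα : IsPrimitiveRoot α n)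
    (hF : Fintype.card F = q) (hqn : q.Coprime n) (x : ZMod n) :
    ∃ g : F[X], g.map (algebraMap F E) =
      ∏ z ∈ (Set.toFinite (qCoset q n x)).toFinset, (X - C (rootPow α z)) := by
  set S := (Set.toFinite (qCoset q n x)).toFinset with hS
  set G : E[X] := ∏ z ∈ S, (X - C (rootPow α z)) with hG
  have hmap : G.map (FiniteField.frobeniusAlgHom F E : E →+* E) = G := by
    rw [hG, Polynomial.map_prod]
    have hu : IsUnit (q : ZMod n) := (ZMod.isUnit_iff_coprime q n).2 hqn
    have himg : S.image (· * (q : ZMod n)) = S := by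
      refine Finset.eq_of_subset_of_card_le (Finset.image_subset_iff.2 fun z hz => ?_) ?_
      · rw [hS, Set.Finite.mem_toFinset] at hz ⊢
        exact mul_mem_qCoset hz
      · rw [Finset.card_image_of_injective _ hu.mul_left_injective]
    conv_rhs => rw [← himg]
    rw [Finset.prod_image hu.mul_left_injective.injOn]
    refine Finset.prod_congr rfl fun z _ => ?_
    rw [rootPow_mul_natCast hα, ← hF]
    simp
  have hlift : G ∈ lifts (algebraMap F E) := by
    rw [lifts_iff_coeff_lifts]
    intro k
    refine mem_range_algebraMap_of_pow_card_eq ?_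
    conv_rhs => rw [← hmap]
    simp
  exact (lifts_iff_set_range G).1 hlift

theorem aeval_minpoly_rootPow_eq_zero_iff [NeZero n] {α : E} (hα : IsPrimitiveRoot α n)
    (hF : Fintype.card F = q) (hqn : q.Coprime n) {x z : ZMod n} :
    aeval (rootPow α z) (minpoly F (rootPow α x)) = 0 ↔ z ∈ qCoset q n x := by
  refine ⟨fun h => ?_, aeval_rootPow_eq_zero_of_mem_qCoset hα hF (minpoly.aeval _ _)⟩
  obtain ⟨g, hg⟩ := exists_map_eq_prod_qCoset (F := F) hα hF hqn x
  have hroot : ∀ w, aeval (rootPow α w) g = 0 ↔ w ∈ qCoset q n x := by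
    intro w
    rw [← eval_map_algebraMap, hg, eval_prod, Finset.prod_eq_zero_iff]
    simp only [Set.Finite.mem_toFinset, eval_sub, eval_X, eval_C, sub_eq_zero,
      (rootPow_injective hα).eq_iff, exists_eq_right']
  have hdvd := minpoly.dvd F (rootPow α x) ((hroot x).2 (self_mem_qCoset x))
  exact (hroot z).1 (aeval_eq_zero_of_dvd_aeval_eq_zero hdvd h)

theorem natDegree_minpoly_rootPow [NeZero n] {α : E} (hα : IsPrimitiveRoot α n)
    (hF : Fintype.card F = q) (hqn : q.Coprime n) (x : ZMod n) :
    (minpoly F (rootPow α x)).natDegree = (qCoset q n x).ncard := by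
  classical
  obtain ⟨g, hg⟩ := exists_map_eq_prod_qCoset (F := F) hα hF hqn x
  have hgdeg : g.natDegree = (qCoset q n x).ncard := by
    rw [← natDegree_map (algebraMap F E), hg, natDegree_finsetProd_X_sub_C_eq_card,
      Set.ncard_eq_toFinset_card _ (Set.toFinite _)]
  have hg0 : g ≠ 0 := by
    rintro rfl
    rw [Polynomial.map_zero] at hg
    exact (monic_prod_of_monic _ _ fun _ _ => monic_X_sub_C _).ne_zero hg.symm
  have hgx : aeval (rootPow α x) g = 0 := by
    rw [← eval_map_algebraMap, hg, eval_prod]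
    exact Finset.prod_eq_zero ((Set.Finite.mem_toFinset _).2 (self_mem_qCoset x)) (by simp)
  have hmin0 : minpoly F (rootPow α x) ≠ 0 := minpoly.ne_zero (isIntegral_rootPow hα x)
  apply le_antisymm
  · rw [← hgdeg]
    exact natDegree_le_of_dvd (minpoly.dvd F _ hgx) hg0
  · rw [Set.ncard_eq_toFinset_card _ (Set.toFinite _),
      ← Finset.card_image_of_injective _ (rootPow_injective hα),
      ← natDegree_map (algebraMap F E)]
    refine card_le_degree_of_subset_roots fun ζ hζ => ?_
    obtain ⟨z, hz, rfl⟩ := Finset.mem_image.1 hζ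
    rw [mem_roots (by simpa using hmin0), IsRoot, eval_map_algebraMap,
      aeval_minpoly_rootPow_eq_zero_iff hα hF hqn]
    exact (Set.Finite.mem_toFinset _).1 hz

/-! ### The cyclic code whose defining set is a cyclotomic coset -/

/-- The ideal is the kernel of evaluation at `α^x`. It is nonzero, since the zero ideal has every
exponent in its defining set. -/
theorem exists_isCyclicCode_definingSet_eq_qCoset [NeZero n] {α : E}
    (hα : IsPrimitiveRoot α n) (hF : Fintype.card F = q) (hqn : q.Coprime n) {x : ZMod n}
    (hx : qCoset q n x ≠ Set.univ) :
    ∃ I : Ideal (CyclicRing F n), IsCyclicCode I ∧ definingSet α I = qCoset q n x := by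
  have hker : ∀ p ∈ Ideal.span {(X : F[X]) ^ n - 1},
      (aeval (rootPow α x) : F[X] →ₐ[F] E) p = 0 := by
    intro p hp
    obtain ⟨s, rfl⟩ := Ideal.mem_span_singleton.1 hp
    simp [rootPow_pow_n hα]
  let I : Ideal (CyclicRing F n) := RingHom.ker (Ideal.Quotient.lift _
    (aeval (rootPow α x) : F[X] →ₐ[F] E).toRingHom hker)
  have hI : ∀ p, CyclicRing.mk F n p ∈ I ↔ aeval (rootPow α x) p = 0 := fun _ => Iff.rfl
  have hdef : definingSet α I = qCoset q n x := by
    ext z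
    constructor
    · intro hz
      exact (aeval_minpoly_rootPow_eq_zero_iff (F := F) hα hF hqn).1
        (hz _ ((hI _).2 (minpoly.aeval _ _)))
    · intro hz p hp
      exact aeval_rootPow_eq_zero_of_mem_qCoset hα hF ((hI p).1 hp) hz
  refine ⟨I, fun hbot => hx ?_, hdef⟩
  rw [← hdef, hbot]
  refine Set.eq_univ_of_forall fun z p hp => ?_
  have hp0 : CyclicRing.mk F n p = CyclicRing.mk F n 0 := by
    rw [map_zero]
    exact (Submodule.mem_bot _).1 hp
  simpa [rootPow] using aeval_eq_of_mk_eq hα hp0 z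

theorem mem_toLinearCode_iff_spectrumAt_eq_zero [NeZero n] {α : E} (hα : IsPrimitiveRoot α n)
    (hF : Fintype.card F = q) {I : Ideal (CyclicRing F n)} {x : ZMod n}
    (hI : definingSet α I = qCoset q n x) {c : Fin n → F} :
    c ∈ toLinearCode I ↔ spectrumAt α c x = 0 := by
  rw [mem_toLinearCode_iff hα, hI]
  refine ⟨fun h => h x (self_mem_qCoset x), fun h z hz => ?_⟩
  rw [spectrumAt_eq_aeval hα] at h ⊢
  exact aeval_rootPow_eq_zero_of_mem_qCoset hα hF h hz

/-- Rank–nullity for evaluation at `α^x`: its kernel is the code and its image is `F[α^x]`, of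
dimension the degree of the minimal polynomial, which is `|C_x|`. -/
theorem finrank_toLinearCode [NeZero n] {α : E} (hα : IsPrimitiveRoot α n)
    (hF : Fintype.card F = q) (hqn : q.Coprime n) {I : Ideal (CyclicRing F n)} {x : ZMod n}
    (hI : definingSet α I = qCoset q n x) :
    (qCoset q n x).ncard + Module.finrank F (toLinearCode I) = n := by
  let ev : (Fin n → F) →ₗ[F] E :=
    Fintype.linearCombination F fun i : Fin n => rootPow α (x * ((i : ℕ) : ZMod n))
  have hev : ∀ c, ev c = spectrumAt α c x := fun c => by
    simp [ev, Fintype.linearCombination_apply, spectrumAt, Algebra.smul_def]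
  have hker : LinearMap.ker ev = toLinearCode I := by
    ext c
    rw [LinearMap.mem_ker, hev, mem_toLinearCode_iff_spectrumAt_eq_zero hα hF hI]
  have hrange : LinearMap.range ev =
      Subalgebra.toSubmodule (Algebra.adjoin F {rootPow α x}) := by
    rw [Algebra.adjoin_singleton_eq_range_aeval]
    ext y
    constructor
    · rintro ⟨c, rfl⟩
      exact ⟨vecToPoly c, by rw [hev, spectrumAt_eq_aeval hα]; rfl⟩
    · rintro ⟨p, rfl⟩
      obtain ⟨c, hc⟩ := exists_vecToRing_eq_mk (NeZero.ne n) p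
      rw [vecToRing_eq_mk] at hc
      exact ⟨c, by rw [hev, spectrumAt_eq_aeval hα, aeval_eq_of_mk_eq hα hc]; rfl⟩
  have h1 := LinearMap.finrank_range_add_finrank_ker ev
  rw [hker, hrange, Module.finrank_fin_fun] at h1
  rw [← natDegree_minpoly_rootPow (F := F) hα hF hqn x,
    ← Algebra.adjoin.powerBasis_dim (isIntegral_rootPow hα x), ← PowerBasis.finrank]
  exact h1

theorem isQuantumCode_cssCode_toLinearCode [DecidableEq F] [NeZero n] {α : E}
    (hα : IsPrimitiveRoot α n) (hF : Fintype.card F = q) (hqn : q.Coprime n)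
    {I : Ideal (CyclicRing F n)} {x : ZMod n} (hI : definingSet α I = qCoset q n x)
    (hne : qCoset q n x ≠ qCoset q n (-x)) {l : ℕ} (hl : HasConsecutive l (qCoset q n x)) :
    IsQuantumCode (n - 2 * (qCoset q n x).ncard) (l + 1) (cssCode (toLinearCode I)) := by
  have hdual := euclideanDual_toLinearCode_le hα hqn hI hne
  refine ⟨?_, detectsBelow_cssCode hdual fun S hS c hc hcS => ?_⟩
  · have h := finrank_toLinearCode hα hF hqn hI
    rw [finrank_cssCode hdual, finrank_euclideanDual]
    congr 1
    omega
  · obtain ⟨b, hb⟩ := hl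
    refine eq_zero_of_spectrumAt_consecutive hα (b := b) (l := l) (fun k hk => ?_) (by omega) hcS
    exact (mem_toLinearCode_iff hα).1 hc _ (hI ▸ hb k hk)

end Minpoly

end

theorem theorem2 {F : Type*} [Field F] [Fintype F] [DecidableEq F]
    {E : Type*} [Field E] [Algebra F E]
    (q n m r : ℕ) (a : ℕ → ℕ) (α : E)
    (hF : Fintype.card F = q) (hq : 3 ≤ q)
    (hm : m = orderOf (q : ZMod n)) (hnm : m < n) (hqn : Nat.gcd q n = 1)
    (hr : 1 ≤ r) (hmr : r + 2 ≤ m)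
    (ha : ∀ i, 1 ≤ i → i ≤ r → 1 ≤ a i ∧ a i < m)
    (hgcd : ∀ i, 1 ≤ i → i ≤ r → Nat.gcd (q ^ a i - 1) n = 1)
    (ht : n ∣ (Finset.Icc 2 r).gcd fun j => (tParam q n a j).val)
    (hα : IsPrimitiveRoot α n) :
    (∃ x : ZMod n, HasConsecutive (r + 1) (qCoset q n x)) ∧
    ∀ x : ZMod n, HasConsecutive (r + 1) (qCoset q n x) →
      qCoset q n x ≠ qCoset q n (-x) →
      2 * (qCoset q n x).ncard < n ∧
      (∃ I : Ideal (CyclicRing F n), IsCyclicCode I ∧ definingSet α I = qCoset q n x) ∧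
      ∀ I : Ideal (CyclicRing F n), IsCyclicCode I → definingSet α I = qCoset q n x →
        euclideanDual (toLinearCode I) ≤ toLinearCode I ∧
        IsQuantumCode (n - 2 * (qCoset q n x).ncard) (r + 2) (cssCode (toLinearCode I)) := by
  have : NeZero n := ⟨by omega⟩
  refine ⟨⟨_, hasConsecutive_qCoset (by omega) hgcd fun j h2 hj => ?_⟩, fun x hx hne => ?_⟩
  · have h := ht.trans (Finset.gcd_dvd (Finset.mem_Icc.2 ⟨h2, hj⟩))
    -- The representative of `t_j` is below `n`, so divisibility by `n` forces `t_j = 0`.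
    exact (ZMod.val_eq_zero _).1 (Nat.eq_zero_of_dvd_of_lt h (ZMod.val_lt _))
  · have hlt := two_mul_ncard_qCoset_lt hqn hne
    refine ⟨hlt, exists_isCyclicCode_definingSet_eq_qCoset hα hF hqn fun huniv => ?_,
      fun I _ hI => ⟨euclideanDual_toLinearCode_le hα hqn hI hne,
        isQuantumCode_cssCode_toLinearCode hα hF hqn hI hne hx⟩⟩
    rw [huniv, Set.ncard_univ, Nat.card_zmod] at hlt
    omega
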